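/- All posets are finite. A poset $P$ is *ranked* of rank $r(P)=n$ if every maximal chain of $P$ has exactly $n+1$ elements. The *rank* of an element $p\in P$ is $c-1$, where $c$ is the largest cardinality of a chain in $\{q\in P : q\le p\}$, and $P(i,j)$ denotes the subposet of all elements whose rank is at least $i$ and at most $j$. The *6-crown* is the poset with six distinct elements $x_0,x_1,x_2,y_0,y_1,y_2$ in which $x_0<y_0>x_1<y_1>x_2<y_2>x_0$ are the only strict comparabilities. A *6-stack* is a ranked poset $P$ of rank $n\ge 1$ such that $P(i,i+1)$ is isomorphic to the 6-crown for every $0\le i<n$. A *section* is either a two-element antichain or a poset whose underlying set consists of distinct elements $[i,k]$ ($0\le i\le 2$, $0\le k\le n$), for some $n\ge 1$, such that, with first coordinates taken modulo $3$: 1. $[i,k]<[i,l]$ whenever $0\le i\le 2$ and $0\le k<l\le n$; 2. $\{[0,k],[1,k],[2,k]\}$ is an antichain for every $0\le k\le n$; 3. $[i,k]<[j,l]$ implies $[i+1,k]<[j+1,l]$, for all $0\le i,j\le 2$ and $0\le k,l\le n$; 4. for every $0\le k<n$ there are $i,j\in\{0,1,2\}$ with $[i,k]\not<[j,k+1]$.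 A *tower of sections* is an ordinal sum of finitely many sections, that is, a poset that is partitioned into subposets $S_0,\dots,S_{m-1}$, each of which is a section, such that $p<q$ whenever $p\in S_a$, $q\in S_b$ and $a<b$. A subset $Q\subseteq P$ (with the induced order) is a *retract* of $P$ if there is an order-preserving map $f:P\to Q$ with $f(q)=q$ for all $q\in Q$; it is *proper* if $Q\ne P$. A poset is *automorphic* if it has an automorphism without fixed points, and *minimal automorphic* if it is automorphic and no proper retract of it is automorphic. **Proposition.** Let $P$ be a 6-stack. Then $P$ has a proper retract that is a tower of sections if and only if $r(P)$ is a multiple of $3$. Moreover, $P$ is minimal automorphic if and only if $r(P)$ is not a multiple of $3$. -/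

import Mathlib

namespace PosetWidth

universe u

/-- The poset `P` is ranked of rank `n`: every maximal chain has exactly `n + 1` elements. -/
def IsRanked (P : Type u) [PartialOrder P] (n : ℕ) : Prop :=
  ∀ C : Set P, IsMaxChain (· ≤ ·) C → C.encard = n + 1

/-- `P(i, j)`: the elements of `P` whose rank lies between `i` and `j`. The rank of `p` is the
height of the poset `{q | q ≤ p}`, that is, `Order.height p`. -/
def rankInterval (P : Type u) [PartialOrder P] (i j : ℕ) : Set P :=
  {p | (i : ℕ∞) ≤ Order.height p ∧ Order.height p ≤ (j : ℕ∞)}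

/-- `Q` is (isomorphic to) the `2n`-crown, `n ≥ 2`: its elements are
`x 0, …, x (n - 1), y 0, …, y (n - 1)`, all distinct, and the only strict comparabilities are
`x 0 < y 0 > x 1 < y 1 > ⋯ > x (n - 1) < y (n - 1) > x 0`. -/
def IsCrown (n : ℕ) (Q : Type u) [PartialOrder Q] : Prop :=
  2 ≤ n ∧ ∃ x y : ZMod n → Q, Function.Bijective (Sum.elim x y) ∧
    ∀ p q : Q, p < q ↔ ∃ i : ZMod n, q = y i ∧ (p = x i ∨ p = x (i + 1))

/-- `P` is a 6-stack of rank `n`: `n ≥ 1`, `P` is ranked of rank `n`, and `P(i, i + 1)` is a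
6-crown for `0 ≤ i < n`. -/
def IsSixStack (P : Type u) [PartialOrder P] (n : ℕ) : Prop :=
  1 ≤ n ∧ IsRanked P n ∧ ∀ i < n, IsCrown 3 (rankInterval P i (i + 1))

/-- `Q` is a section: a two-element antichain, or, for some `n ≥ 1`, a poset whose elements are
the distinct `e (i, k)`, `i` modulo 3 and `0 ≤ k ≤ n`, subject to the four conditions below. -/
def IsSection (Q : Type u) [PartialOrder Q] : Prop :=
  (Nat.card Q = 2 ∧ IsAntichain (· ≤ ·) (Set.univ : Set Q)) ∨
  ∃ n : ℕ, 1 ≤ n ∧ ∃ e : ZMod 3 × Fin (n + 1) ≃ Q,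
    (∀ (i : ZMod 3) (k l : Fin (n + 1)), k < l → e (i, k) < e (i, l)) ∧
    (∀ k : Fin (n + 1), IsAntichain (· ≤ ·) (Set.range fun i : ZMod 3 => e (i, k))) ∧
    (∀ (i j : ZMod 3) (k l : Fin (n + 1)),
      e (i, k) < e (j, l) → e (i + 1, k) < e (j + 1, l)) ∧
    (∀ k : Fin n, ∃ i j : ZMod 3, ¬ e (i, k.castSucc) < e (j, k.succ))

/-- `Q` is a tower of sections: the ordinal sum of finitely many sections. The summands are the
fibres of `b`, and every element of an earlier summand lies below every element of a later one. -/
def IsTowerOfSections (Q : Type u) [PartialOrder Q] : Prop :=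
  ∃ (m : ℕ) (b : Q → Fin m),
    (∀ j : Fin m, IsSection {q : Q // b q = j}) ∧ ∀ p q : Q, b p < b q → p < q

/-- The subset `Q` of `P` is a retract: some order-preserving `f : P → Q` fixes `Q` pointwise. -/
def IsRetract {P : Type u} [PartialOrder P] (Q : Set P) : Prop :=
  ∃ f : P →o Q, ∀ q : Q, f q = q

/-- The poset `P` has a fixed-point-free automorphism. -/
def IsAutomorphic (P : Type u) [PartialOrder P] : Prop :=
  ∃ f : P ≃o P, ∀ p : P, f p ≠ p

/-- `P` is automorphic, and no proper retract of `P` is automorphic. -/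
def IsMinimalAutomorphic (P : Type u) [PartialOrder P] : Prop :=
  IsAutomorphic P ∧ ∀ Q : Set P, IsRetract Q → Q ≠ Set.univ → ¬ IsAutomorphic Q

end PosetWidth

namespace PosetWidth

/-! ### Coordinates on a 6-stack -/

/-! In a 6-crown each upper element misses exactly one lower element, so column labels propagate
from level to level: a 6-stack of rank `n` is unique up to isomorphism, and rotating its columns is
a fixed-point-free automorphism.

Suppose `3 ∤ n`. If a retraction `f` onto `Q` is followed by a fixed-point-free automorphism of `Q`,
the result is a fixed-point-free monotone self-map of `P` with image in `Q`. Such a map sends every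
element to one of its at most four incomparable elements. Level 0 allows no move down, and this
restriction propagates upwards with period 3 (`pairOK_step`). At the top no move up is possible; if
`3 ∤ n`, the restriction there leaves only a common rotation (`pairOK_top`), which is then forced on
all lower levels (`pairOK_back`). So the map is surjective and `Q = P`. Towers of sections are
automorphic, so they are excluded too.

If `3 ∣ n`, an explicit retraction `towerMap` lands on a proper tower of two-element antichains,
which is automorphic. -/

/-- Coordinates on a 6-stack: `e (i, k)` has rank `k` and lies below every element of rank `k + 1`
except `e (i, k + 1)`. -/
def IsStackCoord {P : Type*} [PartialOrder P] {n : ℕ} (e : ZMod 3 × Fin (n + 1) ≃ P) : Prop :=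
  ∀ (i j : ZMod 3) (k l : Fin (n + 1)),
    e (i, k) < e (j, l) ↔ (k : ℕ) + 2 ≤ l ∨ ((k : ℕ) + 1 = l ∧ i ≠ j)

theorem IsRanked.height_le {P : Type*} [PartialOrder P] {n : ℕ} (h : IsRanked P n) (p : P) :
    Order.height p ≤ n := by
  refine Order.height_le fun s _ => ?_
  have hc : IsChain (· ≤ ·) (Set.range s) := by
    rintro _ ⟨a, rfl⟩ _ ⟨b, rfl⟩ _
    exact (le_total a b).imp (fun h => s.monotone h) (fun h => s.monotone h)
  obtain ⟨M, hM, hsub⟩ := hc.exists_maxChain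
  have h1 := Set.encard_le_encard hsub
  rw [h M hM, ← Set.image_univ, s.strictMono.injective.encard_image, Set.encard_univ] at h1
  simp only [ENat.card_eq_coe_fintype_card, Fintype.card_fin] at h1
  have h2 : s.length + 1 ≤ n + 1 := by exact_mod_cast h1
  exact_mod_cast (by omega : s.length ≤ n)

theorem IsCrown.exists_levels {P : Type*} [PartialOrder P] {k : ℕ}
    (h : IsCrown 3 (rankInterval P k (k + 1))) :
    ∃ x y : ZMod 3 → P, Function.Injective x ∧ Function.Injective y ∧
      (∀ p, p ∈ Set.range x ↔ Order.height p = k) ∧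
      (∀ p, p ∈ Set.range y ↔ Order.height p = (k + 1 : ℕ)) ∧
      ∀ a b, x a < y b ↔ a ≠ b := by
  obtain ⟨-, x, y, hbij, hlt⟩ := h
  -- `y b` lies above `x b` and `x (b + 1)`, so the one it misses is `x (b + 2)`.
  have hxy : ∀ a b, x a < y b ↔ a ≠ b + 2 := by
    intro a b
    rw [hlt]
    have hx : Function.Injective x := fun a b h => Sum.inl_injective (hbij.1 (by simpa using h))
    have hy : Function.Injective y := fun a b h => Sum.inr_injective (hbij.1 (by simpa using h))
    have hne : ∀ a b, x a ≠ y b := fun a b h =>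
      Sum.inl_ne_inr (hbij.1 (show Sum.elim x y (.inl a) = Sum.elim x y (.inr b) by simpa using h))
    constructor
    · rintro ⟨i, h1, h2⟩
      rw [hy h1]
      rcases h2 with h2 | h2 <;> rw [hx h2] <;> clear h1 h2 <;> revert i <;> decide
    · intro h
      refine ⟨b, rfl, ?_⟩
      rw [hx.eq_iff, hx.eq_iff]
      revert a b; decide
  have hstep : ∀ p q : rankInterval P k (k + 1), p < q →
      Order.height (p : P) = k ∧ Order.height (q : P) = (k + 1 : ℕ) := by
    intro p q hpq
    have h1 : Order.height (p : P) + 1 ≤ Order.height (q : P) := Order.height_add_one_le hpq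
    have hp := p.2.1
    have hq := q.2.2
    have hq' : Order.height (q : P) ≤ (k + 1 : ℕ) := by exact_mod_cast hq
    obtain ⟨b, hb⟩ := ENat.ne_top_iff_exists.1 (ne_top_of_le_ne_top (ENat.natCast_ne_top _) hq')
    have hpt : Order.height (p : P) ≤ (k + 1 : ℕ) := by exact_mod_cast p.2.2
    obtain ⟨a, ha⟩ := ENat.ne_top_iff_exists.1 (ne_top_of_le_ne_top (ENat.natCast_ne_top _) hpt)
    rw [← hb] at h1 hq' ⊢
    rw [← ha] at h1 hp ⊢
    norm_cast at *
    omega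
  have hxk : ∀ a, Order.height (x a : P) = k := fun a =>
    (hstep (x a) (y a) ((hxy a a).2 (by revert a; decide))).1
  have hyk : ∀ a, Order.height (y a : P) = (k + 1 : ℕ) := fun a =>
    (hstep (x a) (y a) ((hxy a a).2 (by revert a; decide))).2
  -- The shift by 1 turns the missed index `b + 2` into `b + 3 = b`, so that non-related elements
  -- share a label.
  refine ⟨fun a => x a, fun b => y (b + 1), ?_, ?_, ?_, ?_, ?_⟩
  · intro a b hab
    exact Sum.inl_injective (hbij.1 (by simpa [Subtype.ext_iff] using hab))
  · intro a b hab
    exact add_right_cancel (Sum.inr_injective (hbij.1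
      (show Sum.elim x y (.inr (a + 1)) = Sum.elim x y (.inr (b + 1)) by
        simpa [Subtype.ext_iff] using hab)))
  · intro p
    constructor
    · rintro ⟨a, rfl⟩; exact hxk a
    · intro hp
      obtain ⟨a | a, ha⟩ := hbij.2 ⟨p, by
        rw [rankInterval, Set.mem_ofPred_eq, hp]; exact ⟨le_rfl, by norm_cast; omega⟩⟩
      · exact ⟨a, congrArg Subtype.val ha⟩
      · have h1 := hyk a
        rw [show ((y a : rankInterval P k (k + 1)) : P) = p from congrArg Subtype.val ha, hp] at h1
        norm_cast at h1
        omega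
  · intro p
    constructor
    · rintro ⟨a, rfl⟩; exact hyk _
    · intro hp
      obtain ⟨a | a, ha⟩ := hbij.2 ⟨p, by
        rw [rankInterval, Set.mem_ofPred_eq, hp]; exact ⟨by norm_cast; omega, by norm_cast⟩⟩
      · have h1 := hxk a
        rw [show ((x a : rankInterval P k (k + 1)) : P) = p from congrArg Subtype.val ha, hp] at h1
        norm_cast at h1
        omega
      · exact ⟨a - 1, by simpa using congrArg Subtype.val ha⟩
  · intro a b
    refine Iff.trans (hxy a (b + 1)) (not_congr ?_)
    revert a b; decide

theorem IsSixStack.exists_levels {P : Type*} [PartialOrder P] {n : ℕ} (hP : IsSixStack P n) :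
    ∃ c : ℕ → ZMod 3 → P, (∀ k ≤ n, Function.Injective (c k) ∧
      ∀ p, p ∈ Set.range (c k) ↔ Order.height p = k) ∧
      ∀ k < n, ∀ i j, c k i < c (k + 1) j ↔ i ≠ j := by
  obtain ⟨hn, -, hcr⟩ := hP
  -- The hypotheses stand inside the existential so that `choose` gives a total successor function
  -- for the recursion; its values outside them are junk.
  have hstep : ∀ (k : ℕ) (c : ZMod 3 → P), ∃ d : ZMod 3 → P, k < n → Function.Injective c →
      (∀ p, p ∈ Set.range c ↔ Order.height p = k) → Function.Injective d ∧
      (∀ p, p ∈ Set.range d ↔ Order.height p = (k + 1 : ℕ)) ∧ ∀ i j, c i < d j ↔ i ≠ j := by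
    intro k c
    by_cases hk : k < n
    · by_cases hc : Function.Injective c ∧ ∀ p, p ∈ Set.range c ↔ Order.height p = k
      · obtain ⟨x, y, hx, hy, hxr, hyr, hxy⟩ := (hcr k hk).exists_levels
        have hex : ∀ i, ∃ a, x a = c i := fun i => (hxr _).2 ((hc.2 _).1 ⟨i, rfl⟩)
        choose σ hσ using hex
        have hσi : Function.Injective σ := fun a b h => hc.1 (by rw [← hσ, ← hσ, h])
        have hσs : Function.Surjective σ := Finite.surjective_of_injective hσi
        refine ⟨fun j => y (σ j), fun _ _ _ => ⟨hy.comp hσi, fun p => ?_, fun i j => ?_⟩⟩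
        · rw [← hyr]
          constructor
          · rintro ⟨j, rfl⟩; exact ⟨_, rfl⟩
          · rintro ⟨j, rfl⟩
            obtain ⟨i, rfl⟩ := hσs j
            exact ⟨i, rfl⟩
        · rw [← hσ, hxy, hσi.ne_iff]
      · exact ⟨c, fun _ h1 h2 => absurd ⟨h1, h2⟩ hc⟩
    · exact ⟨c, fun h => absurd h hk⟩
  choose next hnext using hstep
  obtain ⟨x, -, hx, -, hxr, -, -⟩ := (hcr 0 (by omega)).exists_levels
  let c : ℕ → ZMod 3 → P := fun k => Nat.rec x next k
  have hc : ∀ k ≤ n, Function.Injective (c k) ∧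
      ∀ p, p ∈ Set.range (c k) ↔ Order.height p = k := by
    intro k
    induction k with
    | zero => exact fun _ => ⟨hx, hxr⟩
    | succ k ih =>
      intro hk
      obtain ⟨h1, h2⟩ := ih (by omega)
      obtain ⟨h3, h4, -⟩ := hnext k (c k) (by omega) h1 h2
      exact ⟨h3, h4⟩
  refine ⟨c, hc, fun k hk => ?_⟩
  obtain ⟨h1, h2⟩ := hc k hk.le
  exact (hnext k (c k) hk h1 h2).2.2

theorem IsSixStack.exists_coord {P : Type*} [PartialOrder P] {n : ℕ} (hP : IsSixStack P n) :
    ∃ e : ZMod 3 × Fin (n + 1) ≃ P, IsStackCoord e := by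
  obtain ⟨c, hc, hlt⟩ := hP.exists_levels
  have hht : ∀ k ≤ n, ∀ i, Order.height (c k i) = k := fun k hk i => ((hc k hk).2 _).1 ⟨i, rfl⟩
  have hgap : ∀ d k, k + 2 + d ≤ n → ∀ i j, c k i < c (k + 2 + d) j := by
    intro d
    induction d with
    | zero =>
      intro k hk i j
      -- With three columns, some intermediate column avoids both ends; hence any two levels at
      -- distance 2 are fully comparable.
      obtain ⟨m, h1, h2⟩ : ∃ m : ZMod 3, i ≠ m ∧ m ≠ j := by revert i j; decide
      exact ((hlt k (by omega) i m).2 h1).trans ((hlt (k + 1) (by omega) m j).2 h2)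
    | succ d ih =>
      intro k hk i j
      exact (ih k (by omega) i (j + 1)).trans
        ((hlt (k + 2 + d) (by omega) (j + 1) j).2 (by revert j; decide))
  have hbij : Function.Bijective fun a : ZMod 3 × Fin (n + 1) => c a.2 a.1 := by
    constructor
    · rintro ⟨i, k⟩ ⟨j, l⟩ h
      have h1 := hht k (by omega) i
      have h2 := hht l (by omega) j
      simp only at h
      rw [h, h2] at h1
      have h3 : l = k := Fin.ext (by exact_mod_cast h1)
      subst h3
      rw [(hc l (by omega)).1 h]
    · intro p
      have hp := hP.2.1.height_le p
      obtain ⟨k, hk⟩ := ENat.ne_top_iff_exists.1 (ne_top_of_le_ne_top (ENat.natCast_ne_top _) hp)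
      rw [← hk] at hp
      have hkn : k ≤ n := by exact_mod_cast hp
      obtain ⟨i, hi⟩ := ((hc k hkn).2 p).2 hk.symm
      exact ⟨(i, ⟨k, by omega⟩), hi⟩
  refine ⟨Equiv.ofBijective _ hbij, fun i j k l => ?_⟩
  obtain ⟨k, hk⟩ := k
  obtain ⟨l, hl⟩ := l
  simp only [Equiv.ofBijective_apply]
  constructor
  · intro h
    have h1 := Order.height_add_one_le h
    rw [hht k (by omega), hht l (by omega)] at h1
    have h2 : k + 1 ≤ l := by exact_mod_cast h1
    rcases h2.eq_or_lt with rfl | h3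
    · exact .inr ⟨rfl, (hlt k (by omega) i j).1 h⟩
    · exact .inl h3
  · rintro (h | ⟨rfl, h⟩)
    · obtain ⟨d, rfl⟩ := Nat.exists_eq_add_of_le h
      exact hgap d k (by omega) i j
    · exact (hlt k (by omega) i j).2 h


/-! ### Towers of sections are automorphic -/

theorem IsSection.isAutomorphic {Q : Type*} [PartialOrder Q] (h : IsSection Q) :
    IsAutomorphic Q := by
  rcases h with ⟨hcard, hanti⟩ | ⟨n, -, e, -, -, hrot, -⟩
  · have hle : ∀ a b : Q, a ≤ b ↔ a = b := fun a b =>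
      ⟨fun hab => by_contra fun hne => hanti (Set.mem_univ _) (Set.mem_univ _) hne hab, le_of_eq⟩
    have : Finite Q := Nat.finite_of_card_ne_zero (by omega)
    let φ : Q ≃ Fin 2 := Finite.equivFinOfCardEq hcard
    refine ⟨⟨φ.trans ((Equiv.addRight 1).trans φ.symm), ?_⟩, fun p hp => ?_⟩
    · intro a b
      rw [hle, hle, EmbeddingLike.apply_eq_iff_eq]
    · have h1 : φ.symm (φ p + 1) = p := hp
      rw [Equiv.symm_apply_eq] at h1
      revert h1
      generalize φ p = a
      revert a; decide
  · have hrot' : ∀ (i j : ZMod 3) (k l : Fin (n + 1)),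
        e (i + 1, k) < e (j + 1, l) ↔ e (i, k) < e (j, l) := by
      refine fun i j k l => ⟨fun h => ?_, hrot i j k l⟩
      have h3 : ∀ i : ZMod 3, i + 1 + 1 + 1 = i := by decide
      -- The rotation has order 3, so two further rotations undo the first.
      have h2 := hrot _ _ _ _ (hrot _ _ _ _ h)
      rwa [h3, h3] at h2
    let ρ : ZMod 3 × Fin (n + 1) ≃ ZMod 3 × Fin (n + 1) :=
      (Equiv.addRight 1).prodCongr (Equiv.refl _)
    have hlt : ∀ a b, e (ρ (e.symm a)) < e (ρ (e.symm b)) ↔ a < b := by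
      intro a b
      obtain ⟨⟨i, k⟩, rfl⟩ := e.surjective a
      obtain ⟨⟨j, l⟩, rfl⟩ := e.surjective b
      simpa [ρ] using hrot' i j k l
    refine ⟨⟨e.symm.trans (ρ.trans e), ?_⟩, fun p hp => ?_⟩
    · intro a b
      rw [le_iff_lt_or_eq, le_iff_lt_or_eq, EmbeddingLike.apply_eq_iff_eq]
      exact or_congr (hlt a b) Iff.rfl
    · obtain ⟨⟨i, k⟩, rfl⟩ := e.surjective p
      have h1 : e (ρ (e.symm (e (i, k)))) = e (i, k) := hp
      simp [ρ] at h1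

/-- Fixed-point-free automorphisms of the summands glue, since the order between different summands
depends only on their positions. -/
theorem IsTowerOfSections.isAutomorphic {Q : Type*} [PartialOrder Q] (h : IsTowerOfSections Q) :
    IsAutomorphic Q := by
  obtain ⟨m, b, hsec, hlt⟩ := h
  choose g hg using fun j => (hsec j).isAutomorphic
  have hcong : ∀ (j : Fin m) (q : Q) (hq : b q = j), (g (b q) ⟨q, rfl⟩ : Q) = g j ⟨q, hq⟩ := by
    rintro _ q rfl; rfl
  have hcong' : ∀ (j : Fin m) (q : Q) (hq : b q = j),
      ((g (b q)).symm ⟨q, rfl⟩ : Q) = (g j).symm ⟨q, hq⟩ := by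
    rintro _ q rfl; rfl
  let f : Q ≃ Q :=
    { toFun := fun q => g (b q) ⟨q, rfl⟩
      invFun := fun q => (g (b q)).symm ⟨q, rfl⟩
      left_inv := fun q => by
        refine (hcong' (b q) _ (g (b q) ⟨q, rfl⟩).2).trans ?_
        simp
      right_inv := fun q => by
        refine (hcong (b q) _ ((g (b q)).symm ⟨q, rfl⟩).2).trans ?_
        simp }
  have hb : ∀ q, b (f q) = b q := fun q => (g (b q) ⟨q, rfl⟩).2
  refine ⟨⟨f, ?_⟩, fun p hp => hg (b p) ⟨p, rfl⟩ (Subtype.ext hp)⟩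
  intro p q
  rcases lt_trichotomy (b p) (b q) with h | h | h
  · exact iff_of_true (hlt _ _ (by rwa [hb, hb])).le (hlt _ _ h).le
  · change (g (b p) ⟨p, rfl⟩ : Q) ≤ g (b q) ⟨q, rfl⟩ ↔ p ≤ q
    rw [hcong (b q) p h, Subtype.coe_le_coe, (g (b q)).le_iff_le, Subtype.mk_le_mk]
  · exact iff_of_false (hlt _ _ (by rwa [hb, hb])).not_ge (hlt _ _ h).not_ge


/-! ### Fixed-point-free endomorphisms of a 6-stack

A fixed-point-free monotone self-map of a finite poset moves every element to an incomparable one.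
In a 6-stack there are four such moves, coded by `Fin 4`: down one level within the column (`0`),
to the next column (`1`) or the one after (`2`) within the level, and up one level within the
column (`3`). -/

/-- If `p` and `h p` were comparable, the iterates of `h` at `p` would form a monotone or antitone
sequence, which by finiteness stabilises at a fixed point. -/
theorem not_lt_of_fixedPointFree {P : Type*} [PartialOrder P] [Finite P] (h : P →o P)
    (hfix : ∀ p, h p ≠ p) (p : P) : ¬ p < h p ∧ ¬ h p < p := by
  constructor
  · intro hp
    have hmono : Monotone fun k : ℕ => h^[k] p := monotone_nat_of_le_succ fun k => by
      rw [Function.iterate_succ_apply]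
      exact h.monotone.iterate k hp.le
    obtain ⟨N, hN⟩ := WellFoundedGT.monotone_chain_condition ⟨_, hmono⟩
    refine hfix (h^[N] p) ?_
    rw [← Function.iterate_succ_apply' h]
    exact (hN (N + 1) (by omega)).symm
  · intro hp
    have hanti : Antitone fun k : ℕ => h^[k] p := antitone_nat_of_succ_le fun k => by
      rw [Function.iterate_succ_apply]
      exact h.monotone.iterate k hp.le
    obtain ⟨N, hN⟩ := WellFoundedGT.monotone_chain_condition
      (α := Pᵒᵈ) ⟨fun k : ℕ => OrderDual.toDual (h^[k] p), hanti.dual_right⟩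
    refine hfix (h^[N] p) ?_
    rw [← Function.iterate_succ_apply' h]
    exact (hN (N + 1) (by omega)).symm

/-- The column shift of a move. -/
def moveCol : Fin 4 → ZMod 3 := ![0, 1, 2, 0]

/-- The level shift of a move, plus one. -/
def moveLev : Fin 4 → ℕ := ![0, 1, 1, 2]

/-- The moves `a` and `b` of two elements of consecutive levels, the upper one being `d ≠ 0`
columns further, preserve their order. -/
def MoveLE (d : ZMod 3) (a b : Fin 4) : Prop :=
  moveLev a + 2 ≤ moveLev b + 1 ∨
    (moveLev a + 1 = moveLev b + 1 ∧ moveCol a ≠ d + moveCol b) ∨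
    (moveLev a = moveLev b + 1 ∧ moveCol a = d + moveCol b)

instance (d : ZMod 3) (a b : Fin 4) : Decidable (MoveLE d a b) := by
  unfold MoveLE; infer_instance

/-- The pairs of moves of `(i, k)` and `(i + 1, k)`, where `k` is congruent to `r` modulo `3`, that
occur in a fixed-point-free monotone map. -/
def PairOK (r : ZMod 3) (a b : Fin 4) : Prop :=
  (r = 0 → a ≠ 0 ∧ b ≠ 0) ∧
  (r = 1 → ¬ ((a = 0 ∨ a = 1) ∧ (b = 0 ∨ b = 2))) ∧
  (r = 2 → ¬ ((a = 0 ∨ a = 2) ∧ (b = 0 ∨ b = 1)))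

instance (r : ZMod 3) (a b : Fin 4) : Decidable (PairOK r a b) := by
  unfold PairOK; infer_instance

/-- A forbidden configuration on one level forces the forbidden one below it. A forbidden pair over
`r = 0` forces the third column below to move down. One over `r = 1` forces the elements of the same
two columns below to move down or swap columns. A move down over `r = 2` forces the other two
columns below to move down or into its column. -/
theorem pairOK_step : ∀ (r : ZMod 3) (a₀ a₁ : Fin 4), PairOK r a₀ a₁ → ∀ a₂, PairOK r a₁ a₂ →
    PairOK r a₂ a₀ → ∀ b₀, MoveLE 2 a₁ b₀ → MoveLE 1 a₂ b₀ → ∀ b₁, MoveLE 1 a₀ b₁ →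
    MoveLE 2 a₂ b₁ → PairOK (r + 1) b₀ b₁ := by
  decide +kernel

/-- Without upward moves, for `r = 1` a move `0` or `1` forces `1` in the next column, and for `r =
2` a move `0` or `2` forces `2`; going once around makes all three equal. -/
theorem pairOK_top : ∀ r : ZMod 3, r ≠ 0 → ∀ a₀ a₁ : Fin 4, PairOK r a₀ a₁ →
    ∀ a₂, PairOK r a₁ a₂ → PairOK r a₂ a₀ → a₀ ≠ 3 → a₁ ≠ 3 → a₂ ≠ 3 →
    (a₀ = 1 ∨ a₀ = 2) ∧ a₁ = a₀ ∧ a₂ = a₀ := by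
  decide +kernel

/-- Under a level rotated by `c`, monotonicity leaves only `c` and the move down; `PairOK` excludes
the latter. -/
theorem pairOK_back : ∀ (r : ZMod 3) (c : Fin 4), c = 1 ∨ c = 2 → ∀ a₀ a₁, PairOK r a₀ a₁ →
    ∀ a₂, PairOK r a₁ a₂ → PairOK r a₂ a₀ → MoveLE 1 a₀ c → MoveLE 1 a₁ c → MoveLE 1 a₂ c →
    MoveLE 2 a₀ c → MoveLE 2 a₁ c → MoveLE 2 a₂ c → a₀ = c := by
  decide +kernel

theorem moves_constant {n : ℕ} (hn : ¬ 3 ∣ n) (s : ℕ → ZMod 3 → Fin 4) (hbot : ∀ i, s 0 i ≠ 0)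
    (htop : ∀ i, s n i ≠ 3)
    (hstep : ∀ k < n, ∀ i d, d ≠ 0 → MoveLE d (s k i) (s (k + 1) (i + d))) :
    ∃ c, (c = 1 ∨ c = 2) ∧ ∀ k ≤ n, ∀ i, s k i = c := by
  have e12 : ∀ i : ZMod 3, i + 1 + 2 = i := by decide
  have e21 : ∀ i : ZMod 3, i + 2 + 1 = i := by decide
  have e11 : ∀ i : ZMod 3, i + 1 + 1 = i + 2 := by decide
  have e22 : ∀ i : ZMod 3, i + 2 + 2 = i + 1 := by decide
  have one : (1 : ZMod 3) ≠ 0 := by decide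
  have two : (2 : ZMod 3) ≠ 0 := by decide
  have hok : ∀ k ≤ n, ∀ i, PairOK k (s k i) (s k (i + 1)) := by
    intro k
    induction k with
    | zero =>
      intro _ i
      refine ⟨fun _ => ⟨hbot _, hbot _⟩, fun h => ?_, fun h => ?_⟩ <;>
        exact absurd h (by rw [Nat.cast_zero]; decide)
    | succ k ih =>
      intro hk i
      have ih := ih (by omega)
      have hs := hstep k (by omega)
      rw [Nat.cast_succ]
      refine pairOK_step k _ _ (ih i) (s k (i + 2)) ?_ ?_ _ ?_ ?_ _ (hs i 1 one) ?_
      · simpa [e11] using ih (i + 1)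
      · simpa [e21] using ih (i + 2)
      · simpa [e12] using hs (i + 1) 2 two
      · simpa [e21] using hs (i + 2) 1 one
      · simpa [e22] using hs (i + 2) 2 two
  have hn0 : (n : ZMod 3) ≠ 0 := fun h => hn ((ZMod.natCast_eq_zero_iff n 3).1 h)
  have htri : ∀ k ≤ n, ∀ i, PairOK k (s k i) (s k (i + 1)) ∧
      PairOK k (s k (i + 1)) (s k (i + 2)) ∧ PairOK k (s k (i + 2)) (s k i) := by
    intro k hk i
    refine ⟨hok k hk i, ?_, ?_⟩
    · simpa [e11] using hok k hk (i + 1)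
    · simpa [e21] using hok k hk (i + 2)
  have hlast : ∀ i, (s n i = 1 ∨ s n i = 2) ∧ s n (i + 1) = s n i ∧ s n (i + 2) = s n i := by
    intro i
    obtain ⟨h1, h2, h3⟩ := htri n le_rfl i
    exact pairOK_top n hn0 _ _ h1 _ h2 h3 (htop _) (htop _) (htop _)
  refine ⟨s n 0, (hlast 0).1, ?_⟩
  have hback : ∀ d k, k + d = n → ∀ i, s k i = s n 0 := by
    intro d
    induction d with
    | zero =>
      rintro k rfl i
      obtain rfl | rfl | rfl : i = 0 ∨ i = 0 + 1 ∨ i = 0 + 2 := by revert i; decide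
      exacts [rfl, (hlast 0).2.1, (hlast 0).2.2]
    | succ d ih =>
      intro k hk i
      have ih := ih (k + 1) (by omega)
      obtain ⟨h1, h2, h3⟩ := htri k (by omega) i
      have hs := hstep k (by omega)
      simp only [ih] at hs
      exact pairOK_back k _ (hlast 0).1 _ _ h1 _ h2 h3 (hs _ 1 one) (hs _ 1 one) (hs _ 1 one)
        (hs _ 2 two) (hs _ 2 two) (hs _ 2 two)
  exact fun k hk => hback (n - k) k (by omega)

theorem IsStackCoord.le_iff {P : Type*} [PartialOrder P] {n : ℕ} {e : ZMod 3 × Fin (n + 1) ≃ P}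
    (he : IsStackCoord e) (p q : P) :
    p ≤ q ↔ ((e.symm p).2 : ℕ) + 2 ≤ (e.symm q).2 ∨
      (((e.symm p).2 : ℕ) + 1 = (e.symm q).2 ∧ (e.symm p).1 ≠ (e.symm q).1) ∨
      (((e.symm p).2 : ℕ) = (e.symm q).2 ∧ (e.symm p).1 = (e.symm q).1) := by
  obtain ⟨⟨i, k⟩, rfl⟩ := e.surjective p
  obtain ⟨⟨j, l⟩, rfl⟩ := e.surjective q
  rw [le_iff_lt_or_eq, he]
  simp [or_assoc, Fin.ext_iff, and_comm]

theorem IsStackCoord.exists_move {P : Type*} [PartialOrder P] {n : ℕ}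
    {e : ZMod 3 × Fin (n + 1) ≃ P} (he : IsStackCoord e) (i : ZMod 3) (k : Fin (n + 1)) (q : P)
    (h₁ : ¬ e (i, k) ≤ q) (h₂ : ¬ q ≤ e (i, k)) :
    ∃ a : Fin 4, (e.symm q).1 = i + moveCol a ∧ ((e.symm q).2 : ℕ) + 1 = k + moveLev a := by
  obtain ⟨⟨j, l⟩, rfl⟩ := e.surjective q
  rw [he.le_iff] at h₁ h₂
  simp only [Equiv.symm_apply_apply] at h₁ h₂ ⊢
  by_cases hij : j = i
  · subst hij
    rcases lt_trichotomy (l : ℕ) k with h | h | h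
    · exact ⟨0, by simp [moveCol], by simp [moveLev]; omega⟩
    · exact absurd (.inr (.inr ⟨h, rfl⟩)) h₂
    · exact ⟨3, by simp [moveCol], by simp [moveLev]; omega⟩
  · have hkl : (l : ℕ) = k := by
      have hji : ¬ i = j := fun h => hij h.symm
      simp only [hij, hji, ne_eq, not_false_eq_true, and_true, and_false, or_false] at h₁ h₂
      omega
    obtain rfl | rfl : j = i + 1 ∨ j = i + 2 := by
      clear h₁ h₂; revert i j; decide
    · exact ⟨1, by simp [moveCol], by simp [moveLev, hkl]⟩
    · exact ⟨2, by simp [moveCol], by simp [moveLev, hkl]⟩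

theorem IsStackCoord.surjective_of_fixedPointFree {P : Type*} [PartialOrder P] [Finite P] {n : ℕ}
    {e : ZMod 3 × Fin (n + 1) ≃ P} (he : IsStackCoord e) (hn : ¬ 3 ∣ n) (h : P →o P)
    (hfix : ∀ p, h p ≠ p) : Function.Surjective h := by
  have hinc : ∀ p, ¬ p ≤ h p ∧ ¬ h p ≤ p := fun p =>
    ⟨fun hp => (not_lt_of_fixedPointFree h hfix p).1 (hp.lt_of_ne (hfix p).symm),
      fun hp => (not_lt_of_fixedPointFree h hfix p).2 (hp.lt_of_ne (hfix p))⟩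
  have hex : ∀ (k : ℕ) (i : ZMod 3), ∃ a : Fin 4, ∀ hk : k < n + 1,
      (e.symm (h (e (i, ⟨k, hk⟩)))).1 = i + moveCol a ∧
      ((e.symm (h (e (i, ⟨k, hk⟩)))).2 : ℕ) + 1 = k + moveLev a := by
    intro k i
    by_cases hk : k < n + 1
    · obtain ⟨a, ha⟩ := he.exists_move i ⟨k, hk⟩ _ (hinc _).1 (hinc _).2
      exact ⟨a, fun _ => ha⟩
    -- Above level `n` the move is an arbitrary default.
    · exact ⟨0, fun h => absurd h hk⟩
  choose s hs using hex
  obtain ⟨c, hc12, hc⟩ := moves_constant hn s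
    (fun i h0 => by
      have h1 := (hs 0 i (by omega)).2
      rw [h0] at h1
      simp [moveLev] at h1)
    (fun i h3 => by
      have h1 := (hs n i (by omega)).2
      have h2 := (e.symm (h (e (i, ⟨n, by omega⟩)))).2.is_lt
      rw [h3] at h1
      simp only [moveLev, Fin.isValue, Matrix.cons_val] at h1
      omega)
    (fun k hk i d hd => by
      obtain ⟨h1, h2⟩ := hs k i (by omega)
      obtain ⟨h3, h4⟩ := hs (k + 1) (i + d) (by omega)
      have hlt : e (i, ⟨k, by omega⟩) < e (i + d, ⟨k + 1, by omega⟩) :=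
        (he _ _ _ _).2 (.inr ⟨rfl, by simpa using hd⟩)
      have hle := (he.le_iff _ _).1 (h.monotone hlt.le)
      rw [h1, h3, add_assoc, add_right_inj, ne_eq, add_right_inj] at hle
      unfold MoveLE
      rcases hle with hle | ⟨hle, hne⟩ | ⟨hle, heq⟩
      · left; omega
      · exact .inr (.inl ⟨by omega, hne⟩)
      · exact .inr (.inr ⟨by omega, heq⟩))
  intro q
  obtain ⟨⟨j, k⟩, rfl⟩ := e.surjective q
  obtain ⟨h1, h2⟩ := hs k (j - moveCol c) k.is_lt
  rw [hc k (by omega)] at h1 h2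
  have hlev : moveLev c = 1 := by rcases hc12 with rfl | rfl <;> rfl
  refine ⟨e (j - moveCol c, k), e.symm.injective (Prod.ext ?_ (Fin.ext ?_))⟩
  · simpa using h1
  · simp only [Equiv.symm_apply_apply]
    rw [hlev] at h2
    exact Nat.succ_injective h2


/-! ### Retracts of a 6-stack -/

theorem IsStackCoord.isAutomorphic {P : Type*} [PartialOrder P] {n : ℕ}
    {e : ZMod 3 × Fin (n + 1) ≃ P} (he : IsStackCoord e) : IsAutomorphic P := by
  let ρ : ZMod 3 × Fin (n + 1) ≃ ZMod 3 × Fin (n + 1) :=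
    (Equiv.addRight 1).prodCongr (Equiv.refl _)
  refine ⟨⟨e.symm.trans (ρ.trans e), ?_⟩, fun p hp => ?_⟩
  · intro a b
    rw [he.le_iff, he.le_iff]
    simp [ρ]
  · obtain ⟨⟨i, k⟩, rfl⟩ := e.surjective p
    have h1 : e (ρ (e.symm (e (i, k)))) = e (i, k) := hp
    simp [ρ] at h1

theorem IsStackCoord.eq_univ_of_isAutomorphic {P : Type*} [PartialOrder P] [Finite P] {n : ℕ}
    {e : ZMod 3 × Fin (n + 1) ≃ P} (he : IsStackCoord e) (hn : ¬ 3 ∣ n) {Q : Set P}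
    (hQ : IsRetract Q) (haut : IsAutomorphic Q) : Q = Set.univ := by
  obtain ⟨f, hf⟩ := hQ
  obtain ⟨g, hg⟩ := haut
  let h : P →o P := ⟨fun p => g (f p), fun p q hpq => g.monotone (f.monotone hpq)⟩
  -- A fixed point of `h` would lie in `Q`, where `f` is the identity, and so be fixed by `g`.
  have hfix : ∀ p, h p ≠ p := by
    intro p hp
    have hpQ : p ∈ Q := hp ▸ (g (f p)).2
    have h1 : f p = ⟨p, hpQ⟩ := hf ⟨p, hpQ⟩
    refine hg ⟨p, hpQ⟩ (Subtype.ext ?_)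
    exact (congrArg (fun x => (g x : P)) h1).symm.trans hp
  refine Set.eq_univ_of_forall fun p => ?_
  obtain ⟨q, rfl⟩ := he.surjective_of_fixedPointFree hn h hfix p
  exact (g (f q)).2

/-- A map on a 6-stack is monotone as soon as it preserves the relations between consecutive
levels. -/
theorem IsStackCoord.monotone {P R : Type*} [PartialOrder P] [Preorder R] {n : ℕ}
    {e : ZMod 3 × Fin (n + 1) ≃ P} (he : IsStackCoord e) {f : P → R}
    (hf : ∀ (i j : ZMod 3) (k l : Fin (n + 1)), (k : ℕ) + 1 = l → i ≠ j →
      f (e (i, k)) ≤ f (e (j, l))) : Monotone f := by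
  have hgap : ∀ (d : ℕ) (i j : ZMod 3) (k l : Fin (n + 1)), (k : ℕ) + 2 + d = l →
      f (e (i, k)) ≤ f (e (j, l)) := by
    intro d
    induction d with
    | zero =>
      intro i j k l hkl
      obtain ⟨m, h1, h2⟩ : ∃ m : ZMod 3, i ≠ m ∧ m ≠ j := by clear hkl; revert i j; decide
      exact (hf i m k ⟨k + 1, by omega⟩ rfl h1).trans (hf m j _ l hkl h2)
    | succ d ih =>
      intro i j k l hkl
      refine (ih i (j + 1) k ⟨k + 2 + d, by omega⟩ rfl).trans (hf _ _ _ l hkl ?_)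
      clear hkl; revert j; decide
  intro p q hpq
  obtain ⟨⟨i, k⟩, rfl⟩ := e.surjective p
  obtain ⟨⟨j, l⟩, rfl⟩ := e.surjective q
  rcases hpq.eq_or_lt with h | h
  · rw [h]
  · rcases (he i j k l).1 h with h | ⟨h, hij⟩
    · obtain ⟨d, hd⟩ := Nat.exists_eq_add_of_le h
      exact hgap d i j k l hd.symm
    · exact hf i j k l h hij

/-- The coordinates that make up a tower of two-element antichains: columns `0` and `1` at the
levels divisible by `3`, and column `2` at the other levels. -/
def InTower (a : ZMod 3 × ℕ) : Prop :=
  (a.2 % 3 = 0 ∧ a.1 ≠ 2) ∨ (a.2 % 3 ≠ 0 ∧ a.1 = 2)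

/-- The retraction, in coordinates, onto the coordinates satisfying `InTower`. -/
def towerMap (a : ZMod 3 × ℕ) : ZMod 3 × ℕ :=
  if a.2 % 3 = 0 then (if a.1 = 2 then 0 else a.1, a.2)
  else if a.1 = 2 then a
  else if a.2 % 3 = 1 then (if a.1 = 0 then (2, a.2 + 1) else (0, a.2 - 1))
  else if a.1 = 0 then (2, a.2 - 1) else (0, a.2 + 1)

theorem inTower_towerMap (a : ZMod 3 × ℕ) : InTower (towerMap a) := by
  obtain ⟨i, k⟩ := a
  have h02 : (0 : ZMod 3) ≠ 2 := by decide
  unfold towerMap InTower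
  split_ifs <;> simp_all <;> omega

theorem towerMap_of_inTower {a : ZMod 3 × ℕ} (h : InTower a) : towerMap a = a := by
  obtain ⟨i, k⟩ := a
  unfold towerMap
  unfold InTower at h
  split_ifs <;> simp_all

/-- Only levels not divisible by 3 are ever raised, and these lie strictly below `n` when `3 ∣ n`.
-/
theorem towerMap_le {n : ℕ} (hn : 3 ∣ n) (a : ZMod 3 × ℕ) (ha : a.2 ≤ n) :
    (towerMap a).2 ≤ n := by
  unfold towerMap
  split_ifs <;> lia

theorem towerMap_mono (i j : ZMod 3) (k : ℕ) (hij : i ≠ j) :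
    (towerMap (i, k)).2 + 2 ≤ (towerMap (j, k + 1)).2 ∨
      ((towerMap (i, k)).2 + 1 = (towerMap (j, k + 1)).2 ∧
        (towerMap (i, k)).1 ≠ (towerMap (j, k + 1)).1) ∨
      ((towerMap (i, k)).2 = (towerMap (j, k + 1)).2 ∧
        (towerMap (i, k)).1 = (towerMap (j, k + 1)).1) := by
  have h02 : (0 : ZMod 3) ≠ 2 := by decide
  have h12 : (1 : ZMod 3) ≠ 2 := by decide
  have h01 : (0 : ZMod 3) ≠ 1 := by decide
  have hi : i = 0 ∨ i = 1 ∨ i = 2 := by clear hij; revert i; decide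
  have hj : j = 0 ∨ j = 1 ∨ j = 2 := by clear hij; revert j; decide
  obtain ⟨h1, h2⟩ | ⟨h1, h2⟩ | ⟨h1, h2⟩ : (k % 3 = 0 ∧ (k + 1) % 3 = 1) ∨
    (k % 3 = 1 ∧ (k + 1) % 3 = 2) ∨ (k % 3 = 2 ∧ (k + 1) % 3 = 0) := by omega
  all_goals
    rcases hi with rfl | rfl | rfl <;> rcases hj with rfl | rfl | rfl <;>
      simp [towerMap, h1, h2, h02, h12, h01, h02.symm, h12.symm, h01.symm] at hij ⊢ <;> omega

/-- The position in the tower of the antichain containing the elements of level `k`. -/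
def towerBlock (k : ℕ) : ℕ :=
  2 * (k / 3) + if k % 3 = 0 then 0 else 1

/-- If the later block is only one level higher, exactly one of the two levels is divisible by 3, so
exactly one of the elements is in column 2. -/
theorem InTower.lt_of_block_lt {a b : ZMod 3 × ℕ} (ha : InTower a) (hb : InTower b)
    (h : towerBlock a.2 < towerBlock b.2) : a.2 + 2 ≤ b.2 ∨ (a.2 + 1 = b.2 ∧ a.1 ≠ b.1) := by
  unfold towerBlock at h
  by_cases hab : a.2 + 2 ≤ b.2
  · exact .inl hab
  · refine .inr ⟨by split_ifs at h <;> omega, fun heq => ?_⟩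
    rcases ha with ⟨h1, h2⟩ | ⟨h1, h2⟩ <;> rcases hb with ⟨h3, h4⟩ | ⟨h3, h4⟩
    · simp only [h1, h3, if_true] at h; omega
    · exact h2 (heq.trans h4)
    · exact h4 (heq ▸ h2)
    · simp only [h1, h3, if_false] at h; omega

theorem InTower.eq_of_block_eq {a b : ZMod 3 × ℕ} (ha : InTower a) (hb : InTower b)
    (h : towerBlock a.2 = towerBlock b.2) (hle : a.2 + 2 ≤ b.2 ∨ (a.2 + 1 = b.2 ∧ a.1 ≠ b.1) ∨
      (a.2 = b.2 ∧ a.1 = b.1)) : a = b := by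
  unfold towerBlock at h
  rcases hle with hle | ⟨hle, hne⟩ | ⟨h1, h2⟩
  · split_ifs at h <;> omega
  · rcases ha with ⟨h1, h2⟩ | ⟨h1, h2⟩ <;> rcases hb with ⟨h3, h4⟩ | ⟨h3, h4⟩
    · omega
    · simp only [h1, h3, if_true, if_false] at h; omega
    · simp only [h1, h3, if_true, if_false] at h; omega
    · exact absurd (h2.trans h4.symm) hne
  · exact Prod.ext h2 h1

/-- Even blocks are columns 0 and 1 of level `3 * t`; odd blocks are column 2 of levels `3 * t + 1`
and `3 * t + 2`. -/
theorem exists_block_pair {n j : ℕ} (hn : 3 ∣ n) (hj : j < 2 * (n / 3) + 1) :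
    ∃ a b : ZMod 3 × ℕ, a ≠ b ∧ (InTower a ∧ a.2 ≤ n ∧ towerBlock a.2 = j) ∧
      (InTower b ∧ b.2 ≤ n ∧ towerBlock b.2 = j) ∧
      ∀ c, InTower c → towerBlock c.2 = j → c = a ∨ c = b := by
  have h02 : (0 : ZMod 3) ≠ 2 := by decide
  have h12 : (1 : ZMod 3) ≠ 2 := by decide
  have h01 : (0 : ZMod 3) ≠ 1 := by decide
  obtain ⟨t, rfl | rfl⟩ : ∃ t, j = 2 * t ∨ j = 2 * t + 1 := ⟨j / 2, by omega⟩
  · refine ⟨(0, 3 * t), (1, 3 * t), by simp, ⟨.inl ⟨by simp, h02⟩, by simp only; omega, ?_⟩,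
      ⟨.inl ⟨by simp, h12⟩, by simp only; omega, ?_⟩, ?_⟩
    · simp [towerBlock]
    · simp [towerBlock]
    · rintro ⟨i, k⟩ hc hk
      unfold towerBlock at hk
      simp only at hk
      have hk3 : k = 3 * t := by split_ifs at hk <;> omega
      subst hk3
      have hi : i ≠ 2 := by
        rcases hc with hc | hc
        · exact hc.2
        · exact absurd (by simp) hc.1
      have : i = 0 ∨ i = 1 := by clear hk hc; revert i; decide
      simpa using this
  · refine ⟨(2, 3 * t + 1), (2, 3 * t + 2), by simp,
      ⟨.inr ⟨by simp only; omega, rfl⟩, by simp only; omega, ?_⟩,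
      ⟨.inr ⟨by simp only; omega, rfl⟩, by simp only; omega, ?_⟩, ?_⟩
    · unfold towerBlock; split_ifs <;> omega
    · unfold towerBlock; split_ifs <;> omega
    · rintro ⟨i, k⟩ hc hk
      unfold towerBlock at hk
      simp only at hk
      have hk3 : k = 3 * t + 1 ∨ k = 3 * t + 2 := by split_ifs at hk <;> omega
      have hi : i = 2 := by
        rcases hc with hc | hc
        · simp only at hc; omega
        · exact hc.2
      subst hi
      simpa using hk3

theorem IsStackCoord.exists_tower {P : Type*} [PartialOrder P] {n : ℕ}
    {e : ZMod 3 × Fin (n + 1) ≃ P} (he : IsStackCoord e) (hn : 3 ∣ n) :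
    ∃ Q : Set P, IsRetract Q ∧ Q ≠ Set.univ ∧ IsTowerOfSections Q := by
  let crd : P → ZMod 3 × ℕ := fun p => ((e.symm p).1, (e.symm p).2)
  have hcrd : ∀ i k, crd (e (i, k)) = (i, (k : ℕ)) := fun i k => by simp [crd]
  have hinj : Function.Injective crd := fun p q h => e.symm.injective
    (Prod.ext (Prod.ext_iff.1 h).1 (Fin.ext (Prod.ext_iff.1 h).2))
  have hle : ∀ p, (crd p).2 ≤ n := fun p => Nat.lt_succ_iff.1 (e.symm p).2.is_lt
  obtain ⟨pt, hpt⟩ : ∃ pt : (a : ZMod 3 × ℕ) → a.2 ≤ n → P, ∀ a ha, crd (pt a ha) = a :=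
    ⟨fun a ha => e (a.1, ⟨a.2, by omega⟩), fun _ _ => hcrd _ _⟩
  refine ⟨{p | InTower (crd p)}, ?_, ?_, ?_⟩
  · let f : P → P := fun p => pt (towerMap (crd p)) (towerMap_le hn _ (hle p))
    have hcf : ∀ p, crd (f p) = towerMap (crd p) := fun p => hpt _ _
    have hmono : Monotone f := he.monotone fun i j k l hkl hij => by
      rw [he.le_iff]
      have h1 := towerMap_mono i j k hij
      have h2 : crd (f (e (i, k))) = towerMap (i, (k : ℕ)) := by rw [hcf, hcrd]
      have h3 : crd (f (e (j, l))) = towerMap (j, (k : ℕ) + 1) := by rw [hcf, hcrd, hkl]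
      rw [← h2, ← h3] at h1
      exact h1
    refine ⟨⟨fun p => ⟨f p, ?_⟩, fun p q hpq => hmono hpq⟩, fun q => Subtype.ext (hinj ?_)⟩
    · change InTower (crd (f p))
      rw [hcf]
      exact inTower_towerMap _
    · change crd (f q) = crd q
      rw [hcf]
      exact towerMap_of_inTower q.2
  · intro h
    have h1 : e (2, 0) ∈ {p | InTower (crd p)} := h ▸ Set.mem_univ _
    have h2 : InTower (crd (e (2, 0))) := h1
    rw [hcrd] at h2
    simp [InTower] at h2
  · have hltcrd : ∀ p q, ((crd p).2 + 2 ≤ (crd q).2 ∨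
        ((crd p).2 + 1 = (crd q).2 ∧ (crd p).1 ≠ (crd q).1)) → p < q := by
      intro p q h
      have h1 := (he (e.symm p).1 (e.symm q).1 (e.symm p).2 (e.symm q).2).2 h
      simpa using h1
    have hblock : ∀ k ≤ n, towerBlock k < 2 * (n / 3) + 1 := by
      intro k hk
      unfold towerBlock
      split_ifs <;> omega
    refine ⟨2 * (n / 3) + 1, fun q => ⟨towerBlock (crd q).2, hblock _ (hle q)⟩, fun j => .inl
      ⟨?_, ?_⟩, fun p q hpq => hltcrd _ _ (InTower.lt_of_block_lt p.2 q.2 (Fin.mk_lt_mk.1 hpq))⟩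
    · obtain ⟨a, b, hne, ⟨ha, han, haj⟩, ⟨hb, hbn, hbj⟩, hall⟩ := exists_block_pair hn j.is_lt
      rw [Nat.card_eq_two_iff]
      refine ⟨⟨⟨pt a han, ?_⟩, Fin.ext ?_⟩, ⟨⟨pt b hbn, ?_⟩, Fin.ext ?_⟩, ?_, ?_⟩
      · change InTower (crd (pt a han))
        rwa [hpt]
      · simpa only [hpt] using haj
      · change InTower (crd (pt b hbn))
        rwa [hpt]
      · simpa only [hpt] using hbj
      · intro h
        have h1 : pt a han = pt b hbn := congrArg (fun x => (x.1 : P)) h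
        exact hne (by rw [← hpt a han, h1, hpt])
      · refine Set.eq_univ_of_forall fun q => ?_
        have hq : crd q.1 = a ∨ crd q.1 = b := hall _ q.1.2 (Fin.ext_iff.1 q.2)
        rw [Set.mem_insert_iff, Set.mem_singleton_iff]
        exact hq.imp (fun h => Subtype.ext (Subtype.ext (hinj (h.trans (hpt _ _).symm))))
          (fun h => Subtype.ext (Subtype.ext (hinj (h.trans (hpt _ _).symm))))
    · intro p _ q _ hne hpq
      refine hne (Subtype.ext (Subtype.ext (hinj (InTower.eq_of_block_eq p.1.2 q.1.2
        (Fin.ext_iff.1 (p.2.trans q.2.symm)) ((he.le_iff _ _).1 hpq)))))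

end PosetWidth

theorem proposition5p11 {P : Type*} [PartialOrder P] [Finite P] (n : ℕ)
    (hP : PosetWidth.IsSixStack P n) :
    ((∃ Q : Set P, PosetWidth.IsRetract Q ∧ Q ≠ Set.univ ∧ PosetWidth.IsTowerOfSections Q) ↔
      3 ∣ n) ∧
    (PosetWidth.IsMinimalAutomorphic P ↔ ¬ 3 ∣ n) := by
  obtain ⟨e, he⟩ := hP.exists_coord
  refine ⟨⟨?_, he.exists_tower⟩, ?_, fun hn => ⟨he.isAutomorphic, ?_⟩⟩
  · rintro ⟨Q, hQ, hne, htower⟩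
    by_contra hn
    exact hne (he.eq_univ_of_isAutomorphic hn hQ htower.isAutomorphic)
  · rintro ⟨-, hmin⟩ hn
    obtain ⟨Q, hQ, hne, htower⟩ := he.exists_tower hn
    exact hmin Q hQ hne htower.isAutomorphic
  · exact fun Q hQ hne haut => hne (he.eq_univ_of_isAutomorphic hn hQ haut)
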